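/- **Setting.** Let $n,m,T$ be natural numbers (state dimension, input dimension, horizon), and let $|\cdot|$ denote Euclidean norms. Consider a controlled system on $\mathbb R^n$ with fixed initial state $x(0)=x_0$ and dynamics $$x(t+1)=f(t,x(t),u(t),\zeta(t)),\qquad t=0,\dots,T-1,$$ where $u(t)\in U_t\subseteq\mathbb R^m$ and, given the past, the noise $\zeta(t)\in\mathbb R^n$ has distribution $\mathcal D(x(t),u(t))$. Let $\hat f(t,x,a)$ be a known function (an estimate of $f(t,x,a,\zeta)$). For each fixed input $a$, $f(t,\cdot,a,\cdot)$ and $\hat f(t,\cdot,a)$ are measurable and $\mathcal D(\cdot,a)$ is a Markov kernel. Put $w(t):=f(t,x(t),u(t),\zeta(t))-\hat f(t,x(t),u(t))$; its distribution is determined by the open-loop control $\mathbf u=(u(0),\dots,u(T-1))$. Let $U:=U_0\times\dots\times U_{T-1}\subseteq\mathbb R^{mT}$ be non-empty. For $\mathbf w\in\mathbb R^{nT}$ and $\mathbf u\in\mathbb R^{mT}$ let $\mathbf x(\mathbf u,\mathbf w)$ be the trajectory with $x(0)=x_0$ and $x(t+1)=\hat f(t,x(t),u(t))+w(t)$, and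 for given real-valued costs $\phi,\varphi$ let $$L(\mathbf w,\mathbf u):=\phi(x(T))+\sum_{t=0}^{T-1}\varphi(x(t),u(t)),\qquad \mathbf x=\mathbf x(\mathbf u,\mathbf w).$$ Fix a probability level $p\in(0,1)$. For $\mathbf u\in U$ define the quantiles and confidence sets $$Q_t(\mathbf u):=\inf\{r:\mathbb P(|w(t)|\le r)\ge 1-p/T\},\qquad C(\mathbf u):=\prod_{t=0}^{T-1}\{w\in\mathbb R^n:|w|\le Q_t(\mathbf u)\},$$ and for $\mathbf u,\mathbf v\in U$ let $g(\mathbf u,\mathbf v):=\max\{L(\mathbf w,\mathbf v):\mathbf w\in C(\mathbf u)\}$, where this maximum is assumed to be attained. An *ideal refinement map* is a map $\mathcal A:U\to U$ with $\mathcal A(\mathbf u)\in\operatorname{argmin}\{g(\mathbf u,\mathbf v):\mathbf v\in U\}$ for every $\mathbf u\in U$. A *performatively stable control* is a $\mathbf u_{PS}\in U$ with $\mathcal A(\mathbf u_{PS})=\mathbf u_{PS}$. **Theorem (existence of performatively stable control).** Suppose that - for every $\mathbf w\in\mathbb R^{nT}$, $L(\mathbf w,\mathbf u)$ is strictly convex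 in $\mathbf u\in U$; - $g(\mathbf u,\mathbf v)$ is jointly continuous in $(\mathbf u,\mathbf v)\in U\times U$; - for each $t=0,\dots,T-1$ the quantile function $Q_t$ is $\epsilon_t$-Lipschitz on $U$, i.e. $|Q_t(\mathbf u)-Q_t(\mathbf u')|\le\epsilon_t|\mathbf u-\mathbf u'|$ for all $\mathbf u,\mathbf u'\in U$; - $U$ is compact and convex. Then an ideal refinement map $\mathcal A$ exists, and every ideal refinement map has a fixed point; that is, there exists at least one performatively stable control. -/

import Mathlib

open MeasureTheory ProbabilityTheory
open scoped NNReal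

/-- `ℝᵏ` with its Euclidean norm. -/
abbrev Euc (k : ℕ) : Type := EuclideanSpace ℝ (Fin k)

/-- Trajectories `(y(0), …, y(T-1))` of vectors of `ℝᵏ`, i.e. `ℝ^{kT}` with its Euclidean norm. -/
abbrev Traj (k T : ℕ) : Type := PiLp 2 (fun _ : Fin T => Euc k)

/-- The data of the control problem with decision-dependent noise: state space `ℝⁿ`, input space
`ℝᵐ`, horizon `T`. -/
structure NoisySystem (n m T : ℕ) where
  /-- the underlying dynamics `x(t+1) = f(t, x(t), u(t), ζ(t))` -/
  f : Fin T → Euc n → Euc m → Euc n → Euc n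
  measurable_f : ∀ t a, Measurable (fun z : Euc n × Euc n => f t z.1 a z.2)
  /-- the known estimate of `f(t, x(t), u(t), ζ(t))` -/
  fhat : Fin T → Euc n → Euc m → Euc n
  measurable_fhat : ∀ t a, Measurable (fun x : Euc n => fhat t x a)
  /-- `D a x` is the distribution of `ζ(t)` when `u(t) = a` and `x(t) = x` -/
  D : Euc m → Kernel (Euc n) (Euc n)
  markov_D : ∀ a, IsMarkovKernel (D a)
  /-- the fixed initial state -/
  x₀ : Euc n
  /-- the terminal cost `φ(x(T))` -/
  terminalCost : Euc n → ℝ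
  /-- the running cost `ϕ(x(t), u(t))` -/
  runningCost : Euc n → Euc m → ℝ
  /-- the admissible inputs `U_t` -/
  inputs : Fin T → Set (Euc m)

namespace NoisySystem

variable {n m T : ℕ} (S : NoisySystem n m T)

/-- The set `U = U_0 × ⋯ × U_{T-1}` of feasible open-loop controls. -/
def controls : Set (Traj m T) := {u | ∀ t, u t ∈ S.inputs t}

/-- The state trajectory `x(u, w)`: `x(0) = x₀`, `x(t+1) = f̂(t, x(t), u(t)) + w(t)`. -/
def state (w : Traj n T) (u : Traj m T) : Fin (T + 1) → Euc n :=
  Fin.induction S.x₀ (fun t x => S.fhat t x (u t) + w t)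

/-- The loss `J(x, u) = φ(x(T)) + ∑ₜ ϕ(x(t), u(t))` of a trajectory. -/
noncomputable def trajectoryLoss (x : Fin (T + 1) → Euc n) (u : Traj m T) : ℝ :=
  S.terminalCost (x (Fin.last T)) + ∑ t : Fin T, S.runningCost (x t.castSucc) (u t)

/-- The loss `L(w, u) = J(x(u, w), u)`. -/
noncomputable def loss (w : Traj n T) (u : Traj m T) : ℝ :=
  S.trajectoryLoss (S.state w u) u

/-- The law of the random state `x(t)` under the control `u`: `x(0) = x₀`, and
`x(t+1) = f(t, x(t), u(t), ζ(t))` where, given the past, `ζ(t)` has law `D(x(t), u(t))`. -/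
noncomputable def stateLaw (u : Traj m T) : Fin (T + 1) → Measure (Euc n) :=
  Fin.induction (Measure.dirac S.x₀)
    (fun t μ => (μ ⊗ₘ S.D (u t)).map (fun z => S.f t z.1 (u t) z.2))

/-- The law of the noise `w(t) = f(t, x(t), u(t), ζ(t)) - f̂(t, x(t), u(t))` under `u`. -/
noncomputable def noiseLaw (u : Traj m T) (t : Fin T) : Measure (Euc n) :=
  (S.stateLaw u t.castSucc ⊗ₘ S.D (u t)).map
    (fun z => S.f t z.1 (u t) z.2 - S.fhat t z.1 (u t))

/-- `Q_t(u) = inf {r : ℙ(|w(t)| ≤ r) ≥ 1 - p/T}`. -/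
noncomputable def quantile (p : ℝ) (t : Fin T) (u : Traj m T) : ℝ :=
  sInf {r : ℝ | 1 - p / (T : ℝ) ≤ (S.noiseLaw u t).real {w | ‖w‖ ≤ r}}

/-- The ideal confidence set `C(u) = C_0(u) × ⋯ × C_{T-1}(u)`, `C_t(u) = {w : |w| ≤ Q_t(u)}`. -/
def confidenceSet (p : ℝ) (u : Traj m T) : Set (Traj n T) :=
  {w | ∀ t, ‖w t‖ ≤ S.quantile p t u}

/-- `g(u, v) = max {L(w, v) : w ∈ C(u)}`, as a supremum. -/
noncomputable def worstCaseLoss (p : ℝ) (u v : Traj m T) : ℝ :=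
  sSup ((fun w => S.loss w v) '' S.confidenceSet p u)

/-- `A : U → U` is an ideal refinement map: `A(u) ∈ argmin {g(u, v) : v ∈ U}`. -/
def IsIdealRefinement (p : ℝ) (A : S.controls → S.controls) : Prop :=
  ∀ u : S.controls, IsMinOn (fun v => S.worstCaseLoss p u v) S.controls (A u)

/-- `u ∈ U` is performatively stable (with respect to the refinement map `A`): `A(u) = u`. -/
def IsPerformativelyStable (A : S.controls → S.controls) (u : S.controls) : Prop :=
  A u = u

end NoisySystem

/-!
The worst-case loss `v ↦ g u v` is a maximum of strictly convex functions that is attained, hence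
strictly convex, so an ideal refinement map is *the* selection of minimizers. Uniqueness makes its
graph closed, closed graph and compactness make it continuous, and Brouwer's theorem applies.

Brouwer's theorem comes from the volume argument of Milnor and Rogers. Let `r = id + h` be a `C¹`
retraction of a ball onto its sphere. For small `t` the map `id + t • h` permutes the ball, so the
integral of its Jacobian is the volume of the ball. This integral is a polynomial in `t`, so it is
also the volume of the ball at `t = 1`, whereas the Jacobian of `r` vanishes identically.
-/

section PolynomialFamilies

open Polynomial

theorem exists_polynomial_eval_eq_det_one_add_smul {R M : Type*} [CommRing R] [Nontrivial R]
    [AddCommGroup M] [Module R M] [Module.Free R M] [Module.Finite R M] (A : M →ₗ[R] M) :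
    ∃ P : R[X], P.natDegree ≤ Module.finrank R M ∧
      ∀ s, P.eval s = LinearMap.det (1 + s • A) := by
  classical
  let b := Module.Free.chooseBasis R M
  let B := LinearMap.toMatrix b b A
  refine ⟨((X : R[X]) • B.map C + (1 : Matrix _ _ R).map C).det, ?_, fun s => ?_⟩
  · rw [Module.finrank_eq_card_chooseBasisIndex]
    exact Polynomial.natDegree_det_X_add_C_le B 1
  · rw [← LinearMap.det_toMatrix b, map_add, map_smul, LinearMap.toMatrix_one,
      ← coe_evalRingHom, RingHom.map_det]
    congr 1
    ext i j
    simp only [RingHom.mapMatrix_apply, Matrix.map_apply, Matrix.add_apply, Matrix.smul_apply,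
      smul_eq_mul, coe_evalRingHom, eval_add, eval_mul, eval_X, eval_C]
    exact add_comm _ _

/-- Both sides are polynomials in the evaluation point, so Lagrange interpolation at finitely many
nodes of `S` carries the identity from `S` to all of `ℝ`. -/
theorem integral_eval_eq_of_infinite {α : Type*} [MeasurableSpace α] {μ : Measure α}
    {P : α → ℝ[X]} {d : ℕ} (hdeg : ∀ x, (P x).natDegree ≤ d) {S : Set ℝ} (hS : S.Infinite)
    {c : ℝ} (hint : ∀ s ∈ S, Integrable (fun x => (P x).eval s) μ)
    (hc : ∀ s ∈ S, ∫ x, (P x).eval s ∂μ = c) (y : ℝ) :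
    ∫ x, (P x).eval y ∂μ = c := by
  obtain ⟨v, hvS, hv⟩ := hS.exists_subset_card_eq (d + 1)
  let ℓ : ℝ → ℝ := fun s => (Lagrange.basis v id s).eval y
  have hinterp (Q : ℝ[X]) (hQ : Q.natDegree ≤ d) : Q.eval y = ∑ s ∈ v, Q.eval s * ℓ s := by
    have hlt : Q.degree < v.card := by
      rw [hv]
      exact degree_le_natDegree.trans_lt (by exact_mod_cast Nat.lt_succ_of_le hQ)
    conv_lhs => rw [Lagrange.eq_interpolate (v := id) Function.injective_id.injOn hlt]
    simp only [Lagrange.interpolate_apply, eval_finsetSum, eval_mul, eval_C, id_eq, ℓ]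
  calc ∫ x, (P x).eval y ∂μ
      = ∫ x, ∑ s ∈ v, (P x).eval s * ℓ s ∂μ := by simp only [fun x => hinterp (P x) (hdeg x)]
    _ = ∑ s ∈ v, c * ℓ s := by
        rw [integral_finsetSum _ fun s hs => (hint s (hvS hs)).mul_const _]
        exact Finset.sum_congr rfl fun s hs => by rw [integral_mul_const, hc s (hvS hs)]
    _ = c := by simpa using (hinterp (C c) (by simp)).symm

end PolynomialFamilies

section Perturbation

open Set

theorem nonempty_inter_frontier_of_isPreconnected {X : Type*} [TopologicalSpace X] {s t : Set X}
    (ht : IsPreconnected t) (hts : (t ∩ s).Nonempty) (htsc : (t \ s).Nonempty) :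
    (t ∩ frontier s).Nonempty := by
  by_contra hempty
  have hcover : t ⊆ interior s ∪ interior sᶜ := by
    rw [← compl_frontier_eq_union_interior]
    exact fun x hxt hx => hempty ⟨x, hxt, hx⟩
  obtain ⟨x, hxt, hxs⟩ := hts
  obtain ⟨y, hyt, hys⟩ := htsc
  obtain ⟨z, -, hzs, hzsc⟩ := ht _ _ isOpen_interior isOpen_interior hcover
    ⟨x, hxt, (hcover hxt).resolve_right fun h => interior_subset h hxs⟩
    ⟨y, hyt, (hcover hyt).resolve_left fun h => hys (interior_subset h)⟩
  exact interior_subset hzsc (interior_subset hzs)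

variable {E F : Type*} [NormedAddCommGroup E] [NormedSpace ℝ E]

theorem lipschitzWith_indicator_of_eqOn_frontier [NormedAddCommGroup F] {s : Set E}
    (hs : IsClosed s) {h : E → F} {c : ℝ≥0} (hlip : LipschitzOnWith c h s)
    (h0 : EqOn h 0 (frontier s)) : LipschitzWith c (s.indicator h) := by
  have key {x y : E} (hx : x ∈ s) (hy : y ∉ s) : dist (h x) 0 ≤ c * dist x y := by
    obtain ⟨z, hz, hzs⟩ := nonempty_inter_frontier_of_isPreconnected
      (convex_segment (𝕜 := ℝ) x y).isPreconnected ⟨x, left_mem_segment ℝ x y, hx⟩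
      ⟨y, right_mem_segment ℝ x y, hy⟩
    calc dist (h x) 0 = dist (h x) (h z) := by rw [h0 hzs, Pi.zero_apply]
      _ ≤ c * dist x z := hlip.dist_le_mul x hx z (hs.frontier_subset hzs)
      _ ≤ c * dist x y := by
        gcongr
        linarith [dist_add_dist_of_mem_segment hz, dist_nonneg (x := z) (y := y)]
  refine LipschitzWith.of_dist_le_mul fun x y => ?_
  by_cases hx : x ∈ s <;> by_cases hy : y ∈ s
  · simpa only [indicator_of_mem, hx, hy] using hlip.dist_le_mul x hx y hy
  · simpa only [indicator_of_mem, indicator_of_notMem, hx, hy, not_false_iff] using key hx hy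
  · simpa only [indicator_of_mem, indicator_of_notMem, hx, hy, not_false_iff, dist_comm]
      using key hy hx
  · simp only [indicator_of_notMem hx, indicator_of_notMem hy, dist_self]
    positivity

theorem bijective_add_of_lipschitzWith_lt_one [NormedAddCommGroup F] [CompleteSpace F] {h : F → F}
    {c : ℝ≥0} (hlip : LipschitzWith c h) (hc : c < 1) :
    Function.Bijective fun x => x + h x := by
  refine ⟨(AntilipschitzWith.id.add_lipschitzWith hlip (by simpa using hc)).injective, fun y => ?_⟩
  have hcontr : ContractingWith c fun x => y - h x :=
    ⟨hc, LipschitzWith.of_dist_le_mul fun x z => by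
      simpa only [dist_sub_left] using hlip.dist_le_mul x z⟩
  exact ⟨hcontr.fixedPoint, (sub_eq_iff_eq_add.1 hcontr.fixedPoint_isFixedPt).symm⟩

/-- Extended by `0` outside `s`, the perturbation makes `x ↦ x + h x` a bijection of the whole space
that fixes every point outside `s`. -/
theorem bijOn_add_of_eqOn_frontier [CompleteSpace E] {s : Set E} (hs : IsClosed s) {h : E → E}
    {c : ℝ≥0} (hlip : LipschitzOnWith c h s) (hc : c < 1) (h0 : EqOn h 0 (frontier s)) :
    BijOn (fun x => x + h x) s s := by
  let φ : E → E := fun x => x + s.indicator h x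
  have hφ : Function.Bijective φ :=
    bijective_add_of_lipschitzWith_lt_one (lipschitzWith_indicator_of_eqOn_frontier hs hlip h0) hc
  have hout {x : E} (hx : x ∉ s) : φ x = x := by simp [φ, hx]
  have hin : EqOn φ (fun x => x + h x) s := fun x hx => by simp [φ, hx]
  refine BijOn.congr ⟨fun x hx => ?_, hφ.1.injOn, fun y hy => ?_⟩ hin
  · by_contra hxs
    exact hxs ((hφ.1 (hout hxs)).symm ▸ hx)
  · obtain ⟨x, rfl⟩ := hφ.2 y
    refine ⟨x, ?_, rfl⟩
    by_contra hxs
    exact hxs (hout hxs ▸ hy)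

end Perturbation

section Volume

open Set

variable {E : Type*} [NormedAddCommGroup E] [NormedSpace ℝ E] [FiniteDimensional ℝ E]

theorem det_one_add_ne_zero_of_norm_lt_one {A : E →L[ℝ] E} (hA : ‖A‖ < 1) :
    (1 + A).det ≠ 0 := by
  have := FiniteDimensional.complete ℝ E
  have hunit : IsUnit (1 + A) := by
    simpa only [sub_neg_eq_add] using isUnit_one_sub_of_norm_lt_one (x := -A) (by rwa [norm_neg])
  exact ((hunit.map ContinuousLinearMap.toLinearMapRingHom).map LinearMap.det).ne_zero

theorem det_one_add_pos_of_norm_lt_one {A : E →L[ℝ] E} (hA : ‖A‖ < 1) : 0 < (1 + A).det := by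
  have hcont : ContinuousOn (fun s : ℝ => (1 + s • A).det) (Icc 0 1) :=
    (ContinuousLinearMap.continuous_det.comp (by fun_prop)).continuousOn
  have hone : (1 : E →L[ℝ] E).det = 1 := map_one (LinearMap.det (M := E) (A := ℝ))
  by_contra! hneg
  obtain ⟨s, hs, hdet⟩ : (0 : ℝ) ∈ (fun s : ℝ => (1 + s • A).det) '' Icc 0 1 :=
    intermediate_value_Icc' zero_le_one hcont ⟨by simpa using hneg, by simp [hone]⟩
  refine det_one_add_ne_zero_of_norm_lt_one ?_ hdet
  calc ‖s • A‖ = s * ‖A‖ := by rw [norm_smul, Real.norm_of_nonneg hs.1]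
    _ ≤ ‖A‖ := mul_le_of_le_one_left (norm_nonneg A) hs.2
    _ < 1 := hA

variable [MeasurableSpace E] [BorelSpace E] (μ : Measure E) [μ.IsAddHaarMeasure]

theorem setIntegral_det_one_add_of_nnnorm_le {K : Set E} (hK : IsClosed K) (hconv : Convex ℝ K)
    {h : E → E} {D : E → E →L[ℝ] E} {c : ℝ≥0} (hc : c < 1)
    (hD : ∀ x ∈ K, HasFDerivWithinAt h (D x) K x) (hDc : ∀ x ∈ K, ‖D x‖₊ ≤ c)
    (h0 : EqOn h 0 (frontier K)) : ∫ x in K, (1 + D x).det ∂μ = μ.real K := by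
  have := FiniteDimensional.complete ℝ E
  have hbij : BijOn (fun x => x + h x) K K := bijOn_add_of_eqOn_frontier hK
    (hconv.lipschitzOnWith_of_nnnorm_hasFDerivWithin_le hD hDc) hc h0
  have hpos (x : E) (hx : x ∈ K) : 0 < (1 + D x).det :=
    det_one_add_pos_of_norm_lt_one ((NNReal.coe_le_coe.2 (hDc x hx)).trans_lt hc)
  calc ∫ x in K, (1 + D x).det ∂μ
      = ∫ x in K, |(1 + D x).det| • (1 : ℝ) ∂μ :=
        setIntegral_congr_fun hK.measurableSet fun x hx => by simp [abs_of_pos (hpos x hx)]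
    _ = ∫ _ in (fun x => x + h x) '' K, (1 : ℝ) ∂μ :=
        (integral_image_eq_integral_abs_det_fderiv_smul μ hK.measurableSet
          (f := fun x => x + h x) (f' := fun x => 1 + D x)
          (fun x hx => (hasFDerivWithinAt_id x K).add (hD x hx)) hbij.injOn fun _ => 1).symm
    _ = μ.real K := by rw [hbij.image_eq, setIntegral_const, smul_eq_mul, mul_one]

/-- For small `t`, the map `x ↦ x + t • h x` permutes `K`, so that `∫ det (1 + t • D x)`, a
polynomial in `t`, is constant near `0`, hence also takes that value at `t = 1`. -/
theorem setIntegral_det_one_add {K : Set E} (hK : IsCompact K) (hconv : Convex ℝ K)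
    {h : E → E} {D : E → E →L[ℝ] E} (hD : ∀ x ∈ K, HasFDerivWithinAt h (D x) K x)
    (hcont : ContinuousOn D K) (h0 : EqOn h 0 (frontier K)) :
    ∫ x in K, (1 + D x).det ∂μ = μ.real K := by
  obtain ⟨C, hC⟩ := hK.exists_bound_of_continuousOn hcont
  have hC0 : 0 < max C 1 := by positivity
  choose P hPdeg hPeval using
    fun x => exists_polynomial_eval_eq_det_one_add_smul (D x : E →ₗ[ℝ] E)
  have heval (x : E) (t : ℝ) : (P x).eval t = (1 + t • D x).det := hPeval x t
  have hvol (t : ℝ) (ht : t ∈ Ioo 0 (max C 1)⁻¹) : ∫ x in K, (P x).eval t ∂μ = μ.real K := by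
    simp only [heval]
    refine setIntegral_det_one_add_of_nnnorm_le μ hK.isClosed hconv (h := fun x => t • h x)
      (c := (t * max C 1).toNNReal) ?_ (fun x hx => (hD x hx).const_smul t) (fun x hx => ?_)
      fun x hx => by simp [h0 hx]
    · rw [Real.toNNReal_lt_one]
      simpa [hC0.ne'] using mul_lt_mul_of_pos_right ht.2 hC0
    · rw [Real.le_toNNReal_iff_coe_le (mul_nonneg ht.1.le hC0.le), coe_nnnorm, norm_smul,
        Real.norm_of_nonneg ht.1.le]
      exact mul_le_mul_of_nonneg_left ((hC x hx).trans (le_max_left C 1)) ht.1.le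
  have hint (t : ℝ) : IntegrableOn (fun x => (P x).eval t) K μ := by
    simp only [heval]
    exact (ContinuousLinearMap.continuous_det.comp_continuousOn
      (continuousOn_const.add (hcont.const_smul t))).integrableOn_compact hK
  simpa only [heval, one_smul] using integral_eval_eq_of_infinite hPdeg
    (Ioo_infinite (inv_pos.2 hC0)) (fun t _ => hint t) hvol 1

end Volume

section NoRetraction

open Set Metric RealInnerProductSpace

variable {E : Type*} [NormedAddCommGroup E] [InnerProductSpace ℝ E] [FiniteDimensional ℝ E]
  {r : E → E} {R : ℝ}

theorem det_fderivWithin_eq_zero_of_mapsTo_sphere {s : Set E} {x : E} (hR : R ≠ 0)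
    (hs : UniqueDiffWithinAt ℝ s x) (hx : x ∈ s) (hr : DifferentiableWithinAt ℝ r s x)
    (hmaps : MapsTo r s (sphere 0 R)) : (fderivWithin ℝ r s x).det = 0 := by
  have hnorm {y : E} (hy : y ∈ s) : ‖r y‖ = R := mem_sphere_zero_iff_norm.1 (hmaps hy)
  have hconst : HasFDerivWithinAt (fun y => ‖r y‖ ^ 2) (0 : E →L[ℝ] ℝ) s x :=
    (hasFDerivWithinAt_const (R ^ 2) x s).congr (fun y hy => by rw [hnorm hy]) (by rw [hnorm hx])
  have horth (v : E) : ⟪r x, fderivWithin ℝ r s x v⟫ = 0 := by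
    simpa using DFunLike.congr_fun (hs.eq hr.hasFDerivWithinAt.norm_sq hconst) v
  by_contra hdet
  obtain ⟨v, hv⟩ : ∃ v, fderivWithin ℝ r s x v = r x :=
    ((Module.End.isUnit_iff _).1
      ((LinearMap.isUnit_iff_isUnit_det _).2 (isUnit_iff_ne_zero.2 hdet))).2 (r x)
  have hzero := horth v
  rw [hv, real_inner_self_eq_norm_sq, hnorm hx] at hzero
  exact hR (pow_eq_zero_iff two_ne_zero |>.1 hzero)

theorem not_mapsTo_sphere_of_eqOn_id (hR : 0 < R) (hr : ContDiffOn ℝ 1 r (closedBall 0 R))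
    (hid : EqOn r id (sphere 0 R)) : ¬ MapsTo r (closedBall 0 R) (sphere 0 R) := by
  intro hmaps
  borelize E
  let B : Set E := closedBall 0 R
  have hB : IsCompact B := isCompact_closedBall 0 R
  have huniq : UniqueDiffOn ℝ B := uniqueDiffOn_convex (convex_closedBall 0 R)
    ⟨0, ball_subset_interior_closedBall (mem_ball_self hR)⟩
  have hdiff : DifferentiableOn ℝ r B := hr.differentiableOn one_ne_zero
  have hvol : ∫ x in B, (1 + (fderivWithin ℝ r B x - 1)).det ∂Measure.addHaar
      = Measure.addHaar.real B :=
    setIntegral_det_one_add _ hB (convex_closedBall 0 R) (h := fun x => r x - x)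
      (fun x hx => (hdiff x hx).hasFDerivWithinAt.sub (hasFDerivWithinAt_id x B))
      ((hr.continuousOn_fderivWithin huniq le_rfl).sub continuousOn_const)
      fun x hx => sub_eq_zero.2 (hid (frontier_closedBall (0 : E) hR.ne' ▸ hx))
  have hzero : ∫ x in B, (1 + (fderivWithin ℝ r B x - 1)).det ∂Measure.addHaar = 0 :=
    setIntegral_eq_zero_of_forall_eq_zero fun x hx => by
      rw [add_sub_cancel]
      exact det_fderivWithin_eq_zero_of_mapsTo_sphere hR.ne' (huniq x hx) hx (hdiff x hx) hmaps
  have hpos : 0 < Measure.addHaar.real B :=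
    ENNReal.toReal_pos (measure_closedBall_pos _ 0 hR).ne' hB.measure_lt_top.ne
  exact hpos.ne' (hvol.symm.trans hzero)

end NoRetraction

section RayExit

open RealInnerProductSpace

variable {E : Type*} [NormedAddCommGroup E] [InnerProductSpace ℝ E] {R : ℝ} {x d : E}

/-- The point at which the ray from `x` in the direction `d` leaves the closed ball of radius `R`
around `0`, namely `x + t • d` for the larger root `t` of
`‖d‖ ^ 2 * t ^ 2 + 2 * ⟪x, d⟫ * t - (R ^ 2 - ‖x‖ ^ 2) = 0`. For `d = 0` its value is `x`. -/
noncomputable def rayExit (R : ℝ) (x d : E) : E :=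
  x + ((-⟪x, d⟫ + √(⟪x, d⟫ ^ 2 + ‖d‖ ^ 2 * (R ^ 2 - ‖x‖ ^ 2))) / ‖d‖ ^ 2) • d

theorem norm_rayExit (hx : ‖x‖ ≤ R) (hd : d ≠ 0) : ‖rayExit R x d‖ = R := by
  have hd0 : ‖d‖ ≠ 0 := norm_ne_zero_iff.2 hd
  have hR : 0 ≤ R := (norm_nonneg x).trans hx
  have hdisc : 0 ≤ ⟪x, d⟫ ^ 2 + ‖d‖ ^ 2 * (R ^ 2 - ‖x‖ ^ 2) := by
    have := sub_nonneg.2 (pow_le_pow_left₀ (norm_nonneg x) hx 2)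
    positivity
  refine (pow_left_inj₀ (norm_nonneg _) hR two_ne_zero).1 ?_
  rw [rayExit, norm_add_sq_real, inner_smul_right, norm_smul, mul_pow, Real.norm_eq_abs, sq_abs]
  field_simp [hd0]
  linear_combination Real.sq_sqrt hdisc

theorem rayExit_eq_self (hx : ‖x‖ = R) (hd : 0 ≤ ⟪x, d⟫) : rayExit R x d = x := by
  rw [rayExit, hx, sub_self, mul_zero, add_zero, Real.sqrt_sq hd, neg_add_cancel, zero_div,
    zero_smul, add_zero]

theorem contDiffWithinAt_rayExit {n : WithTop ℕ∞} {s : Set E} {d : E → E}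
    (hd : ContDiffWithinAt ℝ n d s x) (hx : ‖x‖ ≤ R) (hdx : d x ≠ 0)
    (hout : ‖x‖ = R → 0 < ⟪x, d x⟫) :
    ContDiffWithinAt ℝ n (fun y => rayExit R y (d y)) s x := by
  have hd2 : 0 < ‖d x‖ ^ 2 := pow_pos (norm_pos_iff.2 hdx) 2
  have hdisc : 0 < ⟪x, d x⟫ ^ 2 + ‖d x‖ ^ 2 * (R ^ 2 - ‖x‖ ^ 2) := by
    rcases hx.lt_or_eq with hlt | heq
    · have := sub_pos.2 (pow_lt_pow_left₀ hlt (norm_nonneg x) two_ne_zero)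
      positivity
    · simpa [heq] using pow_pos (hout heq) 2
  have hid : ContDiffWithinAt ℝ n (fun y : E => y) s x := contDiffWithinAt_id
  have hinner : ContDiffWithinAt ℝ n (fun y => ⟪y, d y⟫) s x := hid.inner ℝ hd
  have hsqrt : ContDiffWithinAt ℝ n
      (fun y => √(⟪y, d y⟫ ^ 2 + ‖d y‖ ^ 2 * (R ^ 2 - ‖y‖ ^ 2))) s x :=
    ((hinner.pow 2).add ((hd.norm_sq ℝ).mul
      (contDiffWithinAt_const.sub (hid.norm_sq ℝ)))).sqrt hdisc.ne'
  exact hid.add (((hinner.neg.add hsqrt).div (hd.norm_sq ℝ) hd2.ne').smul hd)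

theorem inner_self_sub_pos_of_norm_le {y : E} (hle : ‖y‖ ≤ ‖x‖) (hne : x ≠ y) :
    0 < ⟪x, x - y⟫ := by
  have hsub : 0 < ‖x - y‖ ^ 2 := pow_pos (norm_sub_pos_iff.2 hne) 2
  have hsq : ‖y‖ ^ 2 ≤ ‖x‖ ^ 2 := pow_le_pow_left₀ (norm_nonneg y) hle 2
  rw [norm_sub_sq_real] at hsub
  rw [inner_sub_right, real_inner_self_eq_norm_sq]
  linarith

end RayExit

section Projection

open RealInnerProductSpace

variable {E : Type*} [NormedAddCommGroup E] [InnerProductSpace ℝ E]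

theorem norm_sub_le_of_inner_sub_nonpos {x y p q : E} (hp : ⟪x - p, q - p⟫ ≤ 0)
    (hq : ⟪y - q, p - q⟫ ≤ 0) : ‖p - q‖ ≤ ‖x - y‖ := by
  have hsq : ‖p - q‖ * ‖p - q‖ ≤ ‖x - y‖ * ‖p - q‖ := by
    calc ‖p - q‖ * ‖p - q‖ = ⟪p - q, p - q⟫ := (real_inner_self_eq_norm_mul_norm _).symm
      _ ≤ ⟪x - y, p - q⟫ := by
        simp only [inner_sub_left, inner_sub_right] at hp hq ⊢
        linarith
      _ ≤ ‖x - y‖ * ‖p - q‖ := real_inner_le_norm _ _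
  rcases (norm_nonneg (p - q)).eq_or_lt with hzero | hpos
  · exact hzero ▸ norm_nonneg _
  · exact le_of_mul_le_mul_right hsq hpos

theorem exists_lipschitzWith_one_retraction {K : Set E} (hK : IsComplete K) (hconv : Convex ℝ K)
    (hne : K.Nonempty) : ∃ P : E → K, LipschitzWith 1 P ∧ ∀ x : K, P x = x := by
  choose P hPK hPmin using exists_norm_eq_iInf_of_complete_convex hne hK hconv
  have hP (x : E) : ∀ y ∈ K, ⟪x - P x, y - P x⟫ ≤ 0 :=
    (norm_eq_iInf_iff_real_inner_le_zero hconv (hPK x)).1 (hPmin x)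
  refine ⟨fun x => ⟨P x, hPK x⟩, LipschitzWith.mk_one fun x y => ?_, fun x => ?_⟩
  · rw [Subtype.dist_eq, dist_eq_norm, dist_eq_norm]
    exact norm_sub_le_of_inner_sub_nonpos (hP x _ (hPK y)) (hP y _ (hPK x))
  · exact Subtype.ext (sub_eq_zero.1 (real_inner_self_nonpos.1 (hP x x x.2))).symm

end Projection

section Brouwer

open Function Metric RealInnerProductSpace

section InnerProductSpace

variable {E : Type*} [NormedAddCommGroup E] [InnerProductSpace ℝ E] [FiniteDimensional ℝ E]

theorem exists_isFixedPt_of_contDiffOn_closedBall {R : ℝ} (hR : 0 < R) {g : E → E}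
    (hg : ContDiffOn ℝ 1 g (closedBall 0 R))
    (hmaps : Set.MapsTo g (closedBall 0 R) (closedBall 0 R)) :
    ∃ x ∈ closedBall (0 : E) R, IsFixedPt g x := by
  by_contra! hfix
  have hle {x : E} (hx : x ∈ closedBall (0 : E) R) : ‖x‖ ≤ R := mem_closedBall_zero_iff.1 hx
  have hne {x : E} (hx : x ∈ closedBall (0 : E) R) : x ≠ g x := fun h => hfix x hx h.symm
  have hout {x : E} (hx : x ∈ closedBall (0 : E) R) (hxR : ‖x‖ = R) : 0 < ⟪x, x - g x⟫ :=
    inner_self_sub_pos_of_norm_le (hxR ▸ hle (hmaps hx)) (hne hx)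
  refine not_mapsTo_sphere_of_eqOn_id hR (r := fun x => rayExit R x (x - g x))
    (fun x hx => ?_) (fun x hx => ?_) fun x hx => ?_
  · exact contDiffWithinAt_rayExit (contDiffWithinAt_id.sub (hg x hx)) (hle hx)
      (sub_ne_zero.2 (hne hx)) (hout hx)
  · have hxR : ‖x‖ = R := mem_sphere_zero_iff_norm.1 hx
    exact rayExit_eq_self hxR (hout (sphere_subset_closedBall hx) hxR).le
  · exact mem_sphere_zero_iff_norm.2 (norm_rayExit (hle hx) (sub_ne_zero.2 (hne hx)))

/-- A smooth approximation of `F` closer than `min ‖F x - x‖` has no fixed point if `F` has none;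
being closer than `1`, it maps the ball of radius `R + 1` to itself. -/
theorem exists_isFixedPt_of_forall_norm_le {F : E → E} (hF : Continuous F) {R : ℝ}
    (hR : ∀ x, ‖F x‖ ≤ R) : ∃ x, IsFixedPt F x := by
  have hR0 : 0 < R + 1 := by linarith [(norm_nonneg _).trans (hR 0)]
  obtain ⟨a, -, hmin⟩ := (isCompact_closedBall (0 : E) (R + 1)).exists_isMinOn
    ⟨0, mem_closedBall_self hR0.le⟩ (hF.dist continuous_id).continuousOn
  by_contra! hfix
  have hδ : 0 < min (dist (F a) a) 1 := lt_min (dist_pos.2 (hfix a)) one_pos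
  obtain ⟨g, hg, hgF, -⟩ := hF.exists_contDiff_approx 1 continuous_const fun _ => hδ
  have hmaps (x : E) : g x ∈ closedBall (0 : E) (R + 1) := by
    rw [mem_closedBall]
    calc dist (g x) 0 ≤ dist (g x) (F x) + dist (F x) 0 := dist_triangle _ _ _
      _ ≤ 1 + R := add_le_add ((hgF x).le.trans (min_le_right _ _)) (by simpa using hR x)
      _ = R + 1 := add_comm 1 R
  obtain ⟨x, hx, hgx⟩ :=
    exists_isFixedPt_of_contDiffOn_closedBall hR0 hg.contDiffOn fun x _ => hmaps x
  have hlt : dist x (F x) < dist (F a) a := by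
    simpa only [hgx.eq] using (hgF x).trans_le (min_le_left _ _)
  exact (dist_comm x (F x) ▸ hlt).not_ge (hmin hx)

theorem exists_isFixedPt_of_isCompact_of_convex_of_innerProductSpace {K : Set E}
    (hK : IsCompact K) (hconv : Convex ℝ K) (hne : K.Nonempty) {F : K → K} (hF : Continuous F) :
    ∃ x, IsFixedPt F x := by
  obtain ⟨P, hP, hPid⟩ := exists_lipschitzWith_one_retraction hK.isComplete hconv hne
  obtain ⟨R, hR⟩ := hK.isBounded.exists_norm_le
  obtain ⟨x, hx⟩ := exists_isFixedPt_of_forall_norm_le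
    (continuous_subtype_val.comp (hF.comp hP.continuous)) fun x => hR _ (F (P x)).2
  refine ⟨P x, ?_⟩
  calc F (P x) = P (F (P x)) := (hPid _).symm
    _ = P x := congrArg P hx

end InnerProductSpace

variable {E : Type*} [AddCommGroup E] [TopologicalSpace E] [IsTopologicalAddGroup E] [T2Space E]
  [Module ℝ E] [ContinuousSMul ℝ E] [FiniteDimensional ℝ E]

theorem exists_isFixedPt_of_isCompact_of_convex {K : Set E} (hK : IsCompact K)
    (hconv : Convex ℝ K) (hne : K.Nonempty) {F : K → K} (hF : Continuous F) :
    ∃ x, IsFixedPt F x := by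
  let e : K ≃ₜ toEuclidean '' K := (toEuclidean (E := E)).toHomeomorph.image K
  obtain ⟨y, hy⟩ := exists_isFixedPt_of_isCompact_of_convex_of_innerProductSpace
    (hK.image toEuclidean.continuous) (hconv.linear_image toEuclidean.toLinearMap)
    (hne.image _) (F := e ∘ F ∘ e.symm) (by fun_prop)
  exact ⟨e.symm y, e.injective (by simpa using hy.eq)⟩

end Brouwer

section Argmin

open Function Set

theorem continuous_of_isClosed_graph {X Y : Type*} [TopologicalSpace X] [TopologicalSpace Y]
    [CompactSpace Y] {f : X → Y} (hf : IsClosed {z : X × Y | f z.1 = z.2}) : Continuous f := by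
  refine continuous_iff_isClosed.2 fun C hC => ?_
  have hpre : f ⁻¹' C = Prod.fst '' ({z : X × Y | f z.1 = z.2} ∩ Prod.snd ⁻¹' C) := by
    ext x
    simp
  rw [hpre]
  exact isClosedMap_fst_of_compactSpace _ (hf.inter (hC.preimage continuous_snd))

theorem continuous_of_forall_isMinOn_iff {X Y α : Type*} [TopologicalSpace X] [TopologicalSpace Y]
    [CompactSpace Y] [TopologicalSpace α] [Preorder α] [OrderClosedTopology α] {g : X → Y → α}
    (hg : Continuous (uncurry g)) {A : X → Y} (hA : ∀ x y, A x = y ↔ IsMinOn (g x) univ y) :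
    Continuous A := by
  refine continuous_of_isClosed_graph ?_
  simp only [hA, isMinOn_univ_iff, ofPred_forall]
  exact isClosed_iInter fun y => isClosed_le hg
    (hg.comp (continuous_fst.prodMk continuous_const))

theorem strictConvexOn_sSup_image {ι E : Type*} [AddCommGroup E] [Module ℝ E] {U : Set E}
    {C : Set ι} {L : ι → E → ℝ} (hL : ∀ w ∈ C, StrictConvexOn ℝ U (L w))
    (hmax : ∀ v ∈ U, ∃ w ∈ C, IsMaxOn (fun w' => L w' v) C w) :
    StrictConvexOn ℝ U fun v => sSup ((fun w => L w v) '' C) := by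
  have hgreatest {v : E} {w : ι} (hw : w ∈ C) (hwmax : IsMaxOn (fun w' => L w' v) C w) :
      IsGreatest ((fun w => L w v) '' C) (L w v) :=
    ⟨mem_image_of_mem _ hw, forall_mem_image.2 hwmax⟩
  have hle {v : E} (hv : v ∈ U) {w : ι} (hw : w ∈ C) : L w v ≤ sSup ((fun w => L w v) '' C) := by
    obtain ⟨w₀, hw₀, hmax₀⟩ := hmax v hv
    exact (hgreatest hw₀ hmax₀).csSup_eq ▸ hmax₀ hw
  have hU : Convex ℝ U := by
    rcases U.eq_empty_or_nonempty with rfl | ⟨v, hv⟩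
    · exact convex_empty
    · obtain ⟨w, hw, -⟩ := hmax v hv
      exact (hL w hw).1
  refine ⟨hU, fun x hx y hy hxy a b ha hb hab => ?_⟩
  obtain ⟨w, hw, hwmax⟩ := hmax _ (hU hx hy ha.le hb.le hab)
  calc sSup ((fun w => L w (a • x + b • y)) '' C) = L w (a • x + b • y) :=
        (hgreatest hw hwmax).csSup_eq
    _ < a • L w x + b • L w y := (hL w hw).2 hx hy hxy ha hb hab
    _ ≤ a • sSup ((fun w => L w x) '' C) + b • sSup ((fun w => L w y) '' C) := by
      gcongr
      exacts [hle hx hw, hle hy hw]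

theorem exists_forall_isMinOn {X Y α : Type*} [TopologicalSpace Y] [LinearOrder α]
    [TopologicalSpace α] [ClosedIicTopology α] {t : Set Y} (ht : IsCompact t) (hne : t.Nonempty)
    {g : X → Y → α} (hg : ∀ x, ContinuousOn (g x) t) :
    ∃ A : X → t, ∀ x, IsMinOn (g x) t (A x) := by
  choose A hAt hA using fun x => ht.exists_isMinOn hne (hg x)
  exact ⟨fun x => ⟨A x, hAt x⟩, hA⟩

theorem continuous_of_strictConvexOn_of_forall_isMinOn {X E : Type*} [TopologicalSpace X]
    [AddCommGroup E] [TopologicalSpace E] [Module ℝ E] {s : Set X} {t : Set E} (ht : IsCompact t)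
    {g : X → E → ℝ} (hg : ContinuousOn (uncurry g) (s ×ˢ t))
    (hconv : ∀ x ∈ s, StrictConvexOn ℝ t (g x)) {A : s → t}
    (hA : ∀ x : s, IsMinOn (g x) t (A x)) : Continuous A := by
  have : CompactSpace t := isCompact_iff_compactSpace.1 ht
  have hg' : Continuous (uncurry fun (x : s) (y : t) => g x y) :=
    hg.comp_continuous (f := fun z : s × t => (z.1.1, z.2.1)) (by fun_prop) fun z => ⟨z.1.2, z.2.2⟩
  refine continuous_of_forall_isMinOn_iff hg' fun x y => ⟨?_, fun hy => ?_⟩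
  · rintro rfl
    exact isMinOn_univ_iff.2 fun y => hA x y.2
  · have hymin : IsMinOn (g x) t y := fun z hz => isMinOn_univ_iff.1 hy ⟨z, hz⟩
    exact Subtype.ext ((hconv x x.2).eq_of_isMinOn (hA x) hymin (A x).2 y.2)

end Argmin

theorem mainTheorem1_general {E W : Type*} [NormedAddCommGroup E] [NormedSpace ℝ E]
    [FiniteDimensional ℝ E] {U : Set E} {C : E → Set W} {L : W → E → ℝ}
    (hne : U.Nonempty) (hcompact : IsCompact U)
    (hmax : ∀ u ∈ U, ∀ v ∈ U, ∃ w ∈ C u, IsMaxOn (fun w' => L w' v) (C u) w)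
    (hstrict : ∀ u ∈ U, ∀ w ∈ C u, StrictConvexOn ℝ U (L w))
    (hcont : ContinuousOn (fun z : E × E => sSup ((fun w => L w z.2) '' C z.1)) (U ×ˢ U)) :
    (∃ A : U → U, ∀ u : U, IsMinOn (fun v => sSup ((fun w => L w v) '' C u)) U (A u)) ∧
      ∀ A : U → U, (∀ u : U, IsMinOn (fun v => sSup ((fun w => L w v) '' C u)) U (A u)) →
        ∃ u, A u = u := by
  let g : E → E → ℝ := fun u v => sSup ((fun w => L w v) '' C u)
  have hconv (u : E) (hu : u ∈ U) : StrictConvexOn ℝ U (g u) :=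
    strictConvexOn_sSup_image (hstrict u hu) (hmax u hu)
  have hcont_right (u : U) : ContinuousOn (g u) U := hcont.uncurry_left (f := g) u.1 u.2
  refine ⟨exists_forall_isMinOn hcompact hne hcont_right, fun A hA => ?_⟩
  exact exists_isFixedPt_of_isCompact_of_convex hcompact (hconv _ hne.some_mem).1 hne
    (continuous_of_strictConvexOn_of_forall_isMinOn (g := g) hcompact hcont hconv hA)

theorem mainTheorem1 {n m T : ℕ} (S : NoisySystem n m T) (p : ℝ) (hp0 : 0 < p) (hp1 : p < 1)
    (ε : Fin T → ℝ≥0)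
    (hne : S.controls.Nonempty)
    (hcompact : IsCompact S.controls)
    (hconvex : Convex ℝ S.controls)
    -- the maximum that defines `g(u, v)` exists
    (hmax : ∀ u ∈ S.controls, ∀ v ∈ S.controls,
      ∃ w ∈ S.confidenceSet p u, IsMaxOn (fun w' => S.loss w' v) (S.confidenceSet p u) w)
    (hstrict : ∀ w : Traj n T, StrictConvexOn ℝ S.controls (fun u => S.loss w u))
    (hcont : ContinuousOn (fun z : Traj m T × Traj m T => S.worstCaseLoss p z.1 z.2)
      (S.controls ×ˢ S.controls))
    (hlip : ∀ t : Fin T, LipschitzOnWith (ε t) (S.quantile p t) S.controls) :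
    (∃ A : S.controls → S.controls, S.IsIdealRefinement p A) ∧
      ∀ A : S.controls → S.controls, S.IsIdealRefinement p A →
        ∃ u : S.controls, S.IsPerformativelyStable A u :=
  mainTheorem1_general (C := S.confidenceSet p) (L := S.loss) hne hcompact hmax
    (fun _ _ w _ => hstrict w) hcont
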